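/- Let $\mathcal P_f$ be the finite power set functor on the category of sets ($\mathcal P_f X$ is the set of finite subsets of $X$, and $\mathcal P_f$ acts on functions by direct images). Let $V_\omega$ be the limit of its terminal chain $1 \xleftarrow{!} \mathcal P_f 1 \xleftarrow{\mathcal P_f !} \mathcal P_f^2 1 \leftarrow \cdots$, i.e. the set of all sequences $x=(x_n)$ with $x_n\in\mathcal P_f^n1$ and $\mathcal P_f^n!(x_{n+1})=x_n$ for all $n$. A *tree* is a directed graph with a root from which every node is reached by a unique directed path; isomorphic trees are identified, and $t_x$ denotes the subtree of $t$ rooted in its node $x$. A *tree bisimulation* on a tree $t$ is a relation $R$ on its nodes such that: if $x\,R\,y$, then every child of $x$ is related to some child of $y$, and some child of $x$ is related to any given child of $y$; the root is related to itself and the root is related to no other node (on either side); and parents of related nodes are related. A tree is *strongly extensional* if every tree bisimulation on it is contained in the diagonal, and *finitely branching* if every node has only finitely many children. Define $\partial_n(t)\in\mathcal P_f^n1$ for all trees $t$ by letting $\partial_0$ be the unique map to $1$ and $\partial_{n+1}(t)=\{\partial_n(t_x) : x \text{ a child of the root of } t\}$. For nodes $x$ of $t$ let $\rho^t_0$ be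 the unique map to $1$ and $\rho^t_{n+1}(x)=\{\rho^t_n(y) : y\text{ a child of }x\}$. A sequence $(x_k)$ of nodes of $t$ *converges* to a node $y$ if for every $n$ one has $\rho^t_n(x_k)=\rho^t_n(y)$ for all sufficiently large $k$. A tree $t$ is *compactly branching* if for every node $x$, every sequence of children of $x$ has a subsequence converging to a child of $x$. For $x,y\in V_\omega$ write $x\leadsto y$ if $y_n\in x_{n+1}$ for all $n$, and let $\mathsf{tr}_x$ be the tree unfolding of the graph $(V_\omega,\leadsto)$ at $x$: its nodes are the finite sequences $\langle x^1,\dots,x^k\rangle$ ($k\ge1$) in $V_\omega$ with $x^1=x$ and $x^i\leadsto x^{i+1}$ for all $i<k$, its root is $\langle x\rangle$, and the children of a node are its extensions by one entry. Let $T=\{\mathsf{tr}_x : x\in V_\omega\}$. Then: 1. $T$ is the collection of all compactly branching, strongly extensional trees, and it is a set. The maps $\partial_n\colon T\to\mathcal P_f^n1$, which satisfy $\partial_n(\mathsf{tr}_x)=x_n$, form a limit cone of the terminal chain; thus $V_\omega\cong T$, via the bijection $x\mapsto\mathsf{tr}_x$. 2. The finitely branching, strongly extensional trees form a set $D$, and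 the coalgebra $\delta\colon D\to\mathcal P_fD$ that sends a tree $t$ to the finite set of its immediate subtrees $\{t_x : x\text{ a child of the root of }t\}$ is a terminal coalgebra for $\mathcal P_f$. -/

import Mathlib

open CategoryTheory CategoryTheory.Limits

universe u

noncomputable section

namespace Worrell

/-! ### The finite power set functor and its terminal chain -/

open Classical in
/-- The finite power set functor on the category of sets: `X ↦ {finite subsets of X}`,
acting on functions by direct images. -/
def Powf : Type u ⥤ Type u where
  obj X := Finset X
  map f := ↾(fun s => Finset.image f s)
  map_id X := by ext s; simp
  map_comp f g := by ext s; simp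

/-- The `n`-th iterate `Powf ^ n 1`. -/
def V : ℕ → Type u
  | 0 => PUnit
  | n + 1 => Powf.obj (V n)

/-- The connecting maps `Powf ^ n ! : Powf ^ (n + 1) 1 → Powf ^ n 1`. -/
def conn : ∀ n : ℕ, V.{u} (n + 1) ⟶ V.{u} n
  | 0 => ↾(fun _ => PUnit.unit)
  | n + 1 => Powf.map (conn n)

/-- The chain `1 ← Powf 1 ← Powf (Powf 1) ← ⋯`. -/
def terminalChain : ℕᵒᵖ ⥤ Type u := Functor.ofOpSequence conn.{u}

/-- Finite subsets of `V n` are the elements of `V (n + 1)`. -/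
def mkV {n : ℕ} (s : Finset (V.{u} n)) : V.{u} (n + 1) := s

/-- The elements of `V (n + 1)` are finite subsets of `V n`. -/
def elems {n : ℕ} (a : V.{u} (n + 1)) : Finset (V.{u} n) := a

instance finite_V : ∀ n : ℕ, Finite (V.{u} n)
  | 0 => inferInstanceAs (Finite PUnit)
  | n + 1 => by
    have := finite_V n
    exact inferInstanceAs (Finite (Finset (V.{u} n)))

/-- The limit of the terminal chain: compatible sequences. -/
def Vomega : Type u := {x : ∀ n : ℕ, V.{u} n // ∀ n, conn n (x (n + 1)) = x n}

/-- The relation `x ⇝ y` on `Vomega`: `y n ∈ x (n + 1)` for all `n`. -/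
def Leads (x y : Vomega.{u}) : Prop := ∀ n, y.1 n ∈ elems (x.1 (n + 1))

/-! ### Trees -/

/-- `l` is the list of successive nodes of a directed path from `a` to `b`
in the directed graph with edge relation `r`. -/
def IsDirPath {α : Type u} (r : α → α → Prop) (a b : α) (l : List α) : Prop :=
  l.IsChain r ∧ l.head? = some a ∧ l.getLast? = some b

/-- A tree: a directed graph with a root from which every node can be reached by a unique
directed path. `Child x y` says that there is an edge from `x` to `y`. -/
structure DirTree : Type (u + 1) where
  Node : Type u
  Child : Node → Node → Prop
  root : Node
  existsUnique_path : ∀ x : Node, ∃! l : List Node, IsDirPath Child root x l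

section paths

variable {α : Type u} {r : α → α → Prop}

theorem IsDirPath.snoc {a b c : α} {l : List α} (h : IsDirPath r a b l) (hbc : r b c) :
    IsDirPath r a c (l ++ [c]) := by
  obtain ⟨h1, h2, h3⟩ := h
  refine ⟨?_, ?_, by simp⟩
  · rw [List.isChain_append]
    refine ⟨h1, by simp, ?_⟩
    intro x hx y hy
    rw [h3] at hx
    simp at hx hy
    subst hx; subst hy; exact hbc
  · rw [List.head?_append, h2]; rfl

theorem IsDirPath.refl (a : α) : IsDirPath r a a [a] := by
  simp [IsDirPath]

theorem IsDirPath.exists_append {a b c : α} {l : List α} (h : IsDirPath r a b l)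
    (hbc : Relation.TransGen r b c) : ∃ k : List α, k ≠ [] ∧ IsDirPath r a c (l ++ k) := by
  induction hbc with
  | single hb => exact ⟨[_], by simp, h.snoc hb⟩
  | @tail d e _ hc ih =>
    obtain ⟨k, _, hk⟩ := ih
    refine ⟨k ++ [e], by simp, ?_⟩
    rw [← List.append_assoc]
    exact hk.snoc hc

theorem IsDirPath.cases {a b : α} {l : List α} (h : IsDirPath r a b l) :
    (l = [a] ∧ a = b) ∨ ∃ k c, l = k ++ [b] ∧ IsDirPath r a c k ∧ r c b := by
  obtain ⟨h1, h2, h3⟩ := h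
  rcases List.eq_nil_or_concat l with rfl | ⟨k, d, rfl⟩
  · simp at h2
  · simp only [List.concat_eq_append] at *
    simp at h3
    subst h3
    rcases List.eq_nil_or_concat k with rfl | ⟨k', c, rfl⟩
    · left; simp at h2; simp [h2]
    · right
      refine ⟨_, c, rfl, ?_, ?_⟩
      · refine ⟨h1.left_of_append, ?_, by simp⟩
        rw [List.concat_eq_append] at *
        cases k' <;> simpa using h2
      · rw [List.isChain_append] at h1
        exact h1.2.2 c (by simp) d (by simp)

/-- A graph in which all nodes are reachable from `a`, no edge ends in `a` and no two
edges end in the same node has unique directed paths from `a`. -/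
theorem existsUnique_path_of {a : α} (hreach : ∀ x, Relation.ReflTransGen r a x)
    (hpar : ∀ x y z, r x z → r y z → x = y) (hroot : ∀ x, ¬ r x a) (x : α) :
    ∃! l : List α, IsDirPath r a x l := by
  have hex : ∀ x, ∃ l : List α, IsDirPath r a x l := by
    intro x
    induction hreach x with
    | refl => exact ⟨_, IsDirPath.refl a⟩
    | tail _ hc ih =>
      obtain ⟨l, hl⟩ := ih
      exact ⟨_, hl.snoc hc⟩
  have huniq : ∀ n : ℕ, ∀ l l' : List α, ∀ x, l.length = n → IsDirPath r a x l →
      IsDirPath r a x l' → l = l' := by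
    intro n
    induction n with
    | zero =>
      intro l l' x hl h _
      rw [List.length_eq_zero_iff] at hl
      subst hl
      simp [IsDirPath] at h
    | succ n ih =>
      intro l l' x hl h h'
      rcases h.cases with ⟨e, e'⟩ | ⟨k, c, e, hk, hc⟩ <;>
        rcases h'.cases with ⟨f, f'⟩ | ⟨k', c', f, hk', hc'⟩
      · rw [e, f]
      · subst e'; exact absurd hc' (hroot _)
      · subst f'; exact absurd hc (hroot _)
      · obtain rfl := hpar _ _ _ hc hc'
        rw [e, f, ih k k' c (by rw [e] at hl; simpa using hl) hk hk']
  obtain ⟨l, hl⟩ := hex x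
  exact ⟨l, hl, fun l' hl' => huniq _ _ _ x rfl hl' hl⟩

end paths

namespace DirTree

theorem parent_unique (t : DirTree.{u}) {x y z : t.Node} (hx : t.Child x z)
    (hy : t.Child y z) : x = y := by
  obtain ⟨l, hl, -⟩ := t.existsUnique_path x
  obtain ⟨l', hl', -⟩ := t.existsUnique_path y
  have h := (t.existsUnique_path z).unique (hl.snoc hx) (hl'.snoc hy)
  have h' : l = l' := List.append_cancel_right h
  have h1 := hl.2.2
  have h2 := hl'.2.2
  rw [h', h2] at h1
  exact (Option.some.inj h1).symm

theorem acyclic (t : DirTree.{u}) (x : t.Node) : ¬ Relation.TransGen t.Child x x := by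
  intro h
  obtain ⟨l, hl, -⟩ := t.existsUnique_path x
  obtain ⟨k, hk, hlk⟩ := hl.exists_append h
  have := (t.existsUnique_path x).unique hlk hl
  simp [hk] at this

/-- The subtree `t_x` of `t` rooted in the node `x`: the nodes reachable from `x`. -/
def subtree (t : DirTree.{u}) (x : t.Node) : DirTree.{u} where
  Node := {y : t.Node // Relation.ReflTransGen t.Child x y}
  Child y z := t.Child y.1 z.1
  root := ⟨x, Relation.ReflTransGen.refl⟩
  existsUnique_path := by
    apply existsUnique_path_of
    · rintro ⟨y, hy⟩
      induction hy with
      | refl => exact Relation.ReflTransGen.refl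
      | tail hb hc ih => exact Relation.ReflTransGen.tail ih hc
    · intro y z w hy hz
      exact Subtype.ext (t.parent_unique hy hz)
    · rintro ⟨y, hy⟩ h
      exact t.acyclic x (Relation.TransGen.tail' hy h)

/-- Isomorphism of trees. -/
def Iso (t s : DirTree.{u}) : Prop := ∃ e : t.Child ≃r s.Child, e t.root = s.root

/-- A graph bisimulation between two trees. -/
def IsGraphBisim (t s : DirTree.{u}) (R : t.Node → s.Node → Prop) : Prop :=
  ∀ x y, R x y →
    (∀ x', t.Child x x' → ∃ y', s.Child y y' ∧ R x' y') ∧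
    (∀ y', s.Child y y' → ∃ x', t.Child x x' ∧ R x' y')

/-- A tree bisimulation between two trees: a graph bisimulation that relates the roots to each
other and to no other nodes, and such that parents of related nodes are related. -/
structure IsTreeBisim (t s : DirTree.{u}) (R : t.Node → s.Node → Prop) : Prop where
  bisim : IsGraphBisim t s R
  root_root : R t.root s.root
  eq_root_right : ∀ y, R t.root y → y = s.root
  eq_root_left : ∀ x, R x s.root → x = t.root
  parents : ∀ x y x' y', t.Child x' x → s.Child y' y → R x y → R x' y'

/-- A tree is strongly extensional if every tree bisimulation on it is contained in the
diagonal. -/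
def StronglyExtensional (t : DirTree.{u}) : Prop :=
  ∀ R : t.Node → t.Node → Prop, IsTreeBisim t t R → ∀ x y, R x y → x = y

/-- Every node has only finitely many children. -/
def FinitelyBranching (t : DirTree.{u}) : Prop := ∀ x : t.Node, {y | t.Child x y}.Finite

/-- The maps `∂ n` from trees to `Powf ^ n 1`, with
`∂ (n + 1) t = {∂ n (t_x) | x a child of the root of t}`. -/
def partialMap : ∀ n : ℕ, DirTree.{u} → V.{u} n
  | 0, _ => PUnit.unit
  | n + 1, t => mkV
      (Set.toFinite ((fun x => partialMap n (t.subtree x)) '' {x | t.Child t.root x})).toFinset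

/-- The maps `ρ n` from the nodes of a tree to `Powf ^ n 1`, with
`ρ (n + 1) x = {ρ n y | y a child of x}`. -/
def rho (t : DirTree.{u}) : ∀ n : ℕ, t.Node → V.{u} n
  | 0, _ => PUnit.unit
  | n + 1, x => mkV (Set.toFinite (rho t n '' {y | t.Child x y})).toFinset

/-- Convergence of a sequence of nodes of a tree. -/
def NodeLim (t : DirTree.{u}) (x : ℕ → t.Node) (y : t.Node) : Prop :=
  ∀ n, ∃ m, ∀ p, m ≤ p → t.rho n (x p) = t.rho n y

/-- For all nodes `x`, every sequence of children of `x` has a subsequence that converges to a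
child of `x`. -/
def CompactlyBranching (t : DirTree.{u}) : Prop :=
  ∀ (x : t.Node) (y : ℕ → t.Node), (∀ n, t.Child x (y n)) →
    ∃ (φ : ℕ → ℕ) (z : t.Node), StrictMono φ ∧ t.Child x z ∧ t.NodeLim (y ∘ φ) z

theorem Iso.symm {t s : DirTree.{u}} (h : Iso t s) : Iso s t := by
  obtain ⟨e, he⟩ := h
  exact ⟨e.symm, by rw [← he, e.symm_apply_apply]⟩

/-- An isomorphism of trees restricts to isomorphisms of subtrees. -/
theorem iso_subtree {t s : DirTree.{u}} (e : t.Child ≃r s.Child) (x : t.Node) :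
    Iso (t.subtree x) (s.subtree (e x)) := by
  have key : ∀ y, Relation.ReflTransGen t.Child x y ↔
      Relation.ReflTransGen s.Child (e x) (e y) := by
    intro y
    constructor
    · intro h
      exact Relation.ReflTransGen.lift (p := s.Child) e (fun a b hab => e.map_rel_iff.2 hab) _ _ h
    · intro h
      have := Relation.ReflTransGen.lift (p := t.Child) e.symm
        (fun a b hab => e.symm.map_rel_iff.2 hab) _ _ h
      simpa [Function.onFun] using this
  exact ⟨⟨e.toEquiv.subtypeEquiv key, fun {a b} => e.map_rel_iff⟩, rfl⟩

theorem Iso.partialMap_eq {t s : DirTree.{u}} (h : Iso t s) (n : ℕ) :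
    partialMap n t = partialMap n s := by
  induction n generalizing t s with
  | zero => rfl
  | succ n ih =>
    obtain ⟨e, he⟩ := h
    unfold partialMap
    congr 1
    rw [Set.Finite.toFinset_inj]
    ext a
    constructor
    · rintro ⟨x, hx, rfl⟩
      refine ⟨e x, ?_, (ih (iso_subtree e x)).symm⟩
      change s.Child s.root (e x)
      rw [← he]; exact e.map_rel_iff.2 hx
    · rintro ⟨y, hy, rfl⟩
      refine ⟨e.symm y, ?_, ?_⟩
      · change t.Child t.root (e.symm y)
        rw [← e.map_rel_iff, he, e.apply_symm_apply]; exact hy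
      · have := ih (iso_subtree e (e.symm y))
        rw [e.apply_symm_apply] at this
        exact this

theorem StronglyExtensional.subtree {t : DirTree.{u}} (h : t.StronglyExtensional) (x : t.Node) :
    (t.subtree x).StronglyExtensional := by
  intro R hR a b hab
  have key := h (fun y z => y = z ∨ ∃ (hy : Relation.ReflTransGen t.Child x y)
    (hz : Relation.ReflTransGen t.Child x z), R ⟨y, hy⟩ ⟨z, hz⟩) ?_ a.1 b.1
    (Or.inr ⟨a.2, b.2, hab⟩)
  · exact Subtype.ext key
  have hroot : ∀ hy : Relation.ReflTransGen t.Child x t.root,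
      (⟨t.root, hy⟩ : (t.subtree x).Node) = (t.subtree x).root := by
    intro hy
    refine Subtype.ext ?_
    change t.root = x
    obtain ⟨l, hl, -⟩ := t.existsUnique_path x
    rcases Relation.reflTransGen_iff_eq_or_transGen.1 hy with e | e
    · exact e
    · obtain ⟨k, hk, hlk⟩ := hl.exists_append e
      have h1 := (t.existsUnique_path t.root).unique hlk (IsDirPath.refl _)
      have h2 : l ≠ [] := by
        rintro rfl
        simp [IsDirPath] at hl
      have h3 := congrArg List.length h1
      have h4 := List.length_pos_iff.2 hk
      have h5 := List.length_pos_iff.2 h2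
      simp at h3
      omega
  refine ⟨?_, Or.inl rfl, ?_, ?_, ?_⟩
  · rintro y z (rfl | ⟨hy, hz, hyz⟩)
    · exact ⟨fun w hw => ⟨w, hw, Or.inl rfl⟩, fun w hw => ⟨w, hw, Or.inl rfl⟩⟩
    · refine ⟨fun w hw => ?_, fun w hw => ?_⟩
      · obtain ⟨v, hv, hwv⟩ := (hR.bisim _ _ hyz).1 ⟨w, hy.tail hw⟩ hw
        exact ⟨v.1, hv, Or.inr ⟨_, v.2, hwv⟩⟩
      · obtain ⟨v, hv, hwv⟩ := (hR.bisim _ _ hyz).2 ⟨w, hz.tail hw⟩ hw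
        exact ⟨v.1, hv, Or.inr ⟨v.2, _, hwv⟩⟩
  · rintro z (rfl | ⟨hy, hz, hyz⟩)
    · rfl
    · rw [hroot hy] at hyz
      have h1 := congrArg Subtype.val (hR.eq_root_right _ hyz)
      have h2 := congrArg Subtype.val (hroot hy)
      exact h1.trans h2.symm
  · rintro z (rfl | ⟨hy, hz, hyz⟩)
    · rfl
    · rw [hroot hz] at hyz
      have h1 := congrArg Subtype.val (hR.eq_root_left _ hyz)
      have h2 := congrArg Subtype.val (hroot hz)
      exact h1.trans h2.symm
  · rintro y z y' z' hy' hz' (rfl | ⟨hy, hz, hyz⟩)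
    · exact Or.inl (t.parent_unique hy' hz')
    · rcases Relation.ReflTransGen.cases_tail hy with e | ⟨p, hp, hpy⟩
      · subst e
        have h1 := congrArg Subtype.val (hR.eq_root_right _ hyz)
        change z = y at h1
        subst h1
        exact Or.inl (t.parent_unique hy' hz')
      · rcases Relation.ReflTransGen.cases_tail hz with e | ⟨q, hq, hqz⟩
        · subst e
          have h1 := congrArg Subtype.val (hR.eq_root_left _ hyz)
          change y = z at h1
          subst h1
          exact Or.inl (t.parent_unique hy' hz')
        · obtain rfl := t.parent_unique hpy hy'
          obtain rfl := t.parent_unique hqz hz'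
          exact Or.inr ⟨hp, hq, hR.parents ⟨y, hy⟩ ⟨z, hz⟩ ⟨p, hp⟩ ⟨q, hq⟩ hpy hqz hyz⟩

theorem FinitelyBranching.subtree {t : DirTree.{u}} (h : t.FinitelyBranching) (x : t.Node) :
    (t.subtree x).FinitelyBranching := by
  intro y
  exact Set.Finite.preimage Subtype.val_injective.injOn (h y.1)

/-- Trees up to isomorphism. -/
instance setoid : Setoid DirTree.{u} where
  r := Iso
  iseqv :=
    { refl := fun t => ⟨RelIso.refl _, rfl⟩
      symm := Iso.symm
      trans := by
        rintro t s v ⟨e, he⟩ ⟨f, hf⟩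
        exact ⟨e.trans f, by rw [RelIso.trans_apply, he, hf]⟩ }

end DirTree

/-- The class of all trees, where isomorphic trees are identified. -/
def TreeClass : Type (u + 1) := Quotient DirTree.setoid.{u}

/-- The isomorphism class of a tree. -/
def DirTree.cls (t : DirTree.{u}) : TreeClass.{u} := Quotient.mk _ t

/-- The maps `∂ n` on trees up to isomorphism. -/
def TreeClass.partialMap (n : ℕ) (q : TreeClass.{u}) : V.{u} n :=
  Quotient.lift (DirTree.partialMap n) (fun _ _ h => DirTree.Iso.partialMap_eq h n) q

/-- The set of immediate subtrees `t_x`, for `x` a child of the root of `t`, on trees up to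
isomorphism. -/
def TreeClass.immediateSubtrees (q : TreeClass.{u}) : Set TreeClass.{u} :=
  Quotient.lift (fun t : DirTree.{u} => {p | ∃ x, t.Child t.root x ∧ p = (t.subtree x).cls})
    (by
      have key : ∀ t s : DirTree.{u}, DirTree.Iso t s →
          {p | ∃ x, t.Child t.root x ∧ p = (t.subtree x).cls} ⊆
          {p | ∃ x, s.Child s.root x ∧ p = (s.subtree x).cls} := by
        rintro t s ⟨e, he⟩ p ⟨x, hx, rfl⟩
        exact ⟨e x, by rw [← he]; exact e.map_rel_iff.2 hx,
          Quotient.sound (DirTree.iso_subtree e x)⟩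
      intro t s h
      exact Set.Subset.antisymm (key t s h) (key s t h.symm)) q

/-! ### The trees `tr x` -/

/-- The tree unfolding of the graph `(Vomega, ⇝)` at `x`: the nodes are the nonempty finite
sequences that start with `x` and whose successive entries are related by `⇝`; the children of
such a sequence are its extensions by one entry. -/
def tr (x : Vomega.{u}) : DirTree.{u} where
  Node := {l : List Vomega.{u} // l.head? = some x ∧ l.IsChain Leads}
  Child l l' := ∃ y z, l.1.getLast? = some y ∧ Leads y z ∧ l'.1 = l.1 ++ [z]
  root := ⟨[x], by simp⟩
  existsUnique_path := by
    apply existsUnique_path_of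
    · rintro ⟨l, hl, hc⟩
      induction l using List.reverseRecOn with
      | nil => simp at hl
      | append_singleton k z ih =>
        rcases List.eq_nil_or_concat k with rfl | ⟨k', y, rfl⟩
        · simp at hl
          subst hl
          exact Relation.ReflTransGen.refl
        · rw [List.concat_eq_append] at *
          have hk : (k' ++ [y]).head? = some x := by
            cases k' <;> simpa using hl
          refine Relation.ReflTransGen.tail (ih hk hc.left_of_append) ?_
          refine ⟨y, z, by simp, ?_, by simp⟩
          rw [List.isChain_append] at hc
          exact hc.2.2 y (by simp) z (by simp)
    · rintro ⟨k, hk⟩ ⟨l, hl⟩ ⟨m, hm⟩ ⟨y, z, _, _, h⟩ ⟨y', z', _, _, h'⟩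
      simp only at h h'
      rw [h] at h'
      exact Subtype.ext (List.append_inj_left' h' rfl)
    · rintro ⟨l, hl, hc⟩ ⟨y, z, hy, _, h⟩
      have h1 := congrArg List.length h
      simp at h1
      subst h1
      simp at hl

/-! ### The limit cone on compactly branching strongly extensional trees -/

/-- The collection of all compactly branching, strongly extensional trees
(up to isomorphism). -/
def compactTrees : Set TreeClass.{u} :=
  {q | ∃ t : DirTree.{u}, t.CompactlyBranching ∧ t.StronglyExtensional ∧ t.cls = q}

theorem DirTree.conn_partialMap (n : ℕ) (t : DirTree.{u}) :
    conn n (DirTree.partialMap (n + 1) t) = DirTree.partialMap n t := by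
  classical
  induction n generalizing t with
  | zero => rfl
  | succ n ih =>
    change (Finset.image (conn n) (elems (DirTree.partialMap (n + 2) t)) : Finset (V n)) =
      elems (DirTree.partialMap (n + 1) t)
    ext a
    simp only [elems, mkV, DirTree.partialMap, Finset.mem_image, Set.Finite.mem_toFinset,
      Set.mem_image]
    constructor
    · rintro ⟨b, ⟨x, hx, rfl⟩, rfl⟩
      exact ⟨x, hx, (ih (t.subtree x)).symm⟩
    · rintro ⟨x, hx, rfl⟩
      exact ⟨_, ⟨x, hx, rfl⟩, ih (t.subtree x)⟩

theorem TreeClass.conn_partialMap (n : ℕ) (q : TreeClass.{u}) :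
    conn n (q.partialMap (n + 1)) = q.partialMap n :=
  Quotient.inductionOn q (DirTree.conn_partialMap n)

/-- The cone over the terminal chain with projections `∂ n` on the set of compactly branching,
strongly extensional trees. (`Shrink` only replaces a small collection by a set of the universe
in question that is in bijection with it.) -/
def treeCone [Small.{u} compactTrees.{u}] : Cone terminalChain.{u} where
  pt := Shrink.{u} compactTrees.{u}
  π := NatTrans.ofOpSequence
    (fun n => ↾(fun s => ((equivShrink compactTrees.{u}).symm s).1.partialMap n))
    (by
      intro n
      ext s
      simp only [terminalChain, Functor.ofOpSequence_map_homOfLE_succ]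
      exact (TreeClass.conn_partialMap n _).symm)

/-! ### The coalgebra of finitely branching strongly extensional trees -/

/-- The collection of all finitely branching, strongly extensional trees
(up to isomorphism). -/
def finiteTrees : Set TreeClass.{u} :=
  {q | ∃ t : DirTree.{u}, t.FinitelyBranching ∧ t.StronglyExtensional ∧ t.cls = q}

theorem finite_immediateSubtrees {q : TreeClass.{u}} (hq : q ∈ finiteTrees.{u}) :
    q.immediateSubtrees.Finite := by
  obtain ⟨t, ht, -, rfl⟩ := hq
  refine ((ht t.root).image (fun x => (t.subtree x).cls)).subset ?_
  rintro p ⟨x, hx, rfl⟩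
  exact ⟨x, hx, rfl⟩

theorem immediateSubtrees_subset {q : TreeClass.{u}} (hq : q ∈ finiteTrees.{u}) :
    q.immediateSubtrees ⊆ finiteTrees.{u} := by
  obtain ⟨t, ht, ht', rfl⟩ := hq
  rintro p ⟨x, hx, rfl⟩
  exact ⟨_, ht.subtree x, ht'.subtree x, rfl⟩

/-- The map that sends a finitely branching, strongly extensional tree to the finite set of its
immediate subtrees, which are again such trees. -/
def delta (q : finiteTrees.{u}) : Finset finiteTrees.{u} :=
  (finite_immediateSubtrees q.2).toFinset.attach.map
    ⟨fun p => ⟨p.1, immediateSubtrees_subset q.2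
      ((Set.Finite.mem_toFinset _).1 p.2)⟩, fun _ _ h => Subtype.ext (Subtype.mk.inj h)⟩

/-- The coalgebra `(D, δ)` for `Powf`, where `D` is the set of finitely branching, strongly
extensional trees and `δ` is `delta`. (For `Shrink`, see `treeCone`.) -/
def treeCoalgebra [Small.{u} finiteTrees.{u}] : Endofunctor.Coalgebra Powf.{u} where
  V := Shrink.{u} finiteTrees.{u}
  str := ↾(fun s => (delta ((equivShrink finiteTrees.{u}).symm s)).map
    (equivShrink finiteTrees.{u}).toEmbedding)

end Worrell

end

namespace Worrell

/-! ### Elements of `Vomega` -/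

/-! The values `ρ n` of a node form a point `rhoLim` of `Vomega`, and an edge of the tree gives a
`⇝`-step between these points. Compact branching is exactly what is needed for the converse: every
`⇝`-successor of `rhoLim x` is `rhoLim` of a child of `x` (`exists_child_rhoLim_eq`). In a compactly
branching tree, having the same sequence of `rhoLim` values along the path from the root is
therefore a tree bisimulation, so under strong extensionality a node is determined by this trace,
and taking traces is an isomorphism onto `tr` of the `rhoLim` of the root (`iso_tr`).

Conversely, `ρ` of a node of `tr x` is its last entry (`rho_tr`), because partial data extend to
`⇝`-successors (`exists_leads`). Distinct siblings thus have distinct values, which forces strong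
extensionality, while compact branching is the sequential compactness of the successor sets in a
product of finite discrete spaces. This gives `T` and the limit.

For the terminal coalgebra, each state has a behaviour in `Vomega`. By the pigeonhole principle the
`⇝`-successors of a behaviour are just the behaviours of the finitely many next states
(`leads_behaviour_iff`), so its `tr` is finitely branching. Trees in `D` lie in `T`, hence are
determined by all `∂ n`, which yields both the homomorphism property and uniqueness. -/

theorem mem_elems_conn {n : ℕ} (a : V.{u} (n + 2)) (b : V.{u} n) :
    b ∈ elems (conn (n + 1) a) ↔ ∃ c ∈ elems a, conn n c = b := by
  classical
  change b ∈ (Finset.image (conn n) (elems a) : Finset (V n)) ↔ _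
  simp

theorem V_ext {n : ℕ} {a b : V.{u} (n + 1)} (h : ∀ c, c ∈ elems a ↔ c ∈ elems b) : a = b :=
  Finset.ext h

theorem Vomega.ext {x y : Vomega.{u}} (h : ∀ n, x.1 n = y.1 n) : x = y :=
  Subtype.ext (funext h)

theorem conn_mem_elems {x : Vomega.{u}} {n : ℕ} {a : V.{u} (n + 1)}
    (ha : a ∈ elems (x.1 (n + 2))) : conn n a ∈ elems (x.1 (n + 1)) := by
  rw [← x.2 (n + 1), mem_elems_conn]
  exact ⟨a, ha, rfl⟩

theorem exists_conn_eq {x : Vomega.{u}} {n : ℕ} {a : V.{u} n} (ha : a ∈ elems (x.1 (n + 1))) :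
    ∃ b ∈ elems (x.1 (n + 2)), conn n b = a := by
  rwa [← x.2 (n + 1), mem_elems_conn] at ha

/-- If two elements of `Vomega` agree at `m`, then they agree at all `n ≤ m`. -/
theorem Vomega.eq_of_le {x y : Vomega.{u}} {n m : ℕ} (hnm : n ≤ m) :
    x.1 m = y.1 m → x.1 n = y.1 n := by
  induction m, hnm using Nat.le_induction with
  | base => exact id
  | succ m _ ih =>
    intro h
    apply ih
    rw [← x.2 m, ← y.2 m, h]

/-- The thread below level `n` consists of the projections of `a`. The values of `s` above `n` are
arbitrary; a total function merely avoids dependence on a bound. -/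
theorem exists_partial_thread (x : Vomega.{u}) (n : ℕ) (a : V.{u} n)
    (ha : a ∈ elems (x.1 (n + 1))) :
    ∃ s : ∀ k, V.{u} k, s n = a ∧ (∀ k ≤ n, s k ∈ elems (x.1 (k + 1))) ∧
      ∀ k < n, conn k (s (k + 1)) = s k := by
  induction n with
  | zero =>
    refine ⟨Function.update (fun k => x.1 k) 0 a, by simp, ?_, by simp⟩
    intro k hk
    obtain rfl : k = 0 := by omega
    simpa using ha
  | succ n ih =>
    obtain ⟨s, hs, hmem, hconn⟩ := ih (conn n a) (conn_mem_elems ha)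
    refine ⟨Function.update s (n + 1) a, by simp, fun k hk => ?_, fun k hk => ?_⟩
    · rcases hk.eq_or_lt with rfl | hk
      · simpa using ha
      · rw [Function.update_of_ne (by omega)]
        exact hmem k (by omega)
    · rw [Function.update_of_ne (by omega : k ≠ n + 1)]
      rcases (Nat.lt_succ_iff.1 hk).eq_or_lt with rfl | hk
      · simp [hs]
      · rw [Function.update_of_ne (by omega)]
        exact hconn k hk

/-- Every element of `x (n + 1)` is the `n`-th component of some `y` with `x ⇝ y`. -/
theorem exists_leads (x : Vomega.{u}) {n : ℕ} {a : V.{u} n} (ha : a ∈ elems (x.1 (n + 1))) :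
    ∃ y, Leads x y ∧ y.1 n = a := by
  classical
  obtain ⟨s, hs, hmem, hconn⟩ := exists_partial_thread x n a ha
  -- Membership of `b` is a premise inside the existential, so that `choose` yields a total lifting
  -- function usable in a recursion.
  have hlift : ∀ k (b : V.{u} k), ∃ c : V.{u} (k + 1),
      b ∈ elems (x.1 (k + 1)) → c ∈ elems (x.1 (k + 2)) ∧ conn k c = b := by
    intro k b
    by_cases hb : b ∈ elems (x.1 (k + 1))
    · obtain ⟨c, hc⟩ := exists_conn_eq hb
      exact ⟨c, fun _ => hc⟩
    · exact ⟨x.1 (k + 1), fun h => absurd h hb⟩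
  choose lift hlift using hlift
  -- Follow the given thread up to level `n`, then lift one level at a time.
  let y : ∀ k, V.{u} k := fun k => Nat.rec (motive := fun k => V.{u} k) (s 0)
    (fun k b => if k < n then s (k + 1) else lift k b) k
  have y_succ : ∀ k, y (k + 1) = if k < n then s (k + 1) else lift k (y k) := fun _ => rfl
  have y_eq : ∀ k ≤ n, y k = s k := by
    rintro (_ | k) hk
    · rfl
    · rw [y_succ, if_pos (by omega)]
  have y_mem : ∀ k, y k ∈ elems (x.1 (k + 1)) := by
    intro k
    induction k with
    | zero => exact hmem 0 (Nat.zero_le n)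
    | succ k ih =>
      rw [y_succ]
      split_ifs with h
      · exact hmem _ h
      · exact (hlift k _ ih).1
  refine ⟨⟨y, fun k => ?_⟩, y_mem, (y_eq n le_rfl).trans hs⟩
  rw [y_succ]
  split_ifs with h
  · rw [hconn k h, y_eq k h.le]
  · exact (hlift k _ (y_mem k)).2

/-- Every sequence of successors of `x` has a subsequence that converges to a successor
of `x`. -/
theorem exists_subseq_leads (x : Vomega.{u}) (z : ℕ → Vomega.{u}) (hz : ∀ k, Leads x (z k)) :
    ∃ (φ : ℕ → ℕ) (y : Vomega.{u}), StrictMono φ ∧ Leads x y ∧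
      ∀ n, ∃ m, ∀ p, m ≤ p → (z (φ p)).1 n = y.1 n := by
  -- With discrete finite factors the product is compact and first countable, and convergence means
  -- that each component is eventually constant.
  let _ : ∀ n, TopologicalSpace (V.{u} n) := fun _ => ⊥
  have : ∀ n, DiscreteTopology (V.{u} n) := fun _ => ⟨rfl⟩
  obtain ⟨y, φ, hφ, hlim⟩ := CompactSpace.tendsto_subseq (fun k => (z k).1)
  have hev : ∀ n, ∀ᶠ p in Filter.atTop, (z (φ p)).1 n = y n := by
    intro n
    have h := (tendsto_pi_nhds.1 hlim) n
    rw [nhds_discrete, Filter.tendsto_pure] at h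
    exact h
  refine ⟨φ, ⟨y, fun n => ?_⟩, hφ, fun n => ?_, fun n => ?_⟩
  · obtain ⟨p, h1, h2⟩ := ((hev n).and (hev (n + 1))).exists
    rw [← h1, ← h2, (z (φ p)).2]
  · obtain ⟨p, hp⟩ := (hev n).exists
    change y n ∈ _
    rw [← hp]
    exact hz _ n
  · exact Filter.eventually_atTop.1 (hev n)

/-! ### The maps `ρ` -/

namespace DirTree

variable (t : DirTree.{u})

theorem mem_elems_rho {n : ℕ} {x : t.Node} {a : V.{u} n} :
    a ∈ elems (t.rho (n + 1) x) ↔ ∃ y, t.Child x y ∧ t.rho n y = a := by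
  simp [rho, elems, mkV]

theorem mem_elems_partialMap {n : ℕ} {a : V.{u} n} :
    a ∈ elems (partialMap (n + 1) t) ↔
      ∃ x, t.Child t.root x ∧ partialMap n (t.subtree x) = a := by
  simp [partialMap, elems, mkV]

theorem conn_rho (n : ℕ) (x : t.Node) : conn n (t.rho (n + 1) x) = t.rho n x := by
  induction n generalizing x with
  | zero => rfl
  | succ n ih =>
    refine V_ext fun c => ?_
    rw [mem_elems_conn, mem_elems_rho]
    constructor
    · rintro ⟨b, hb, rfl⟩
      obtain ⟨y, hy, rfl⟩ := t.mem_elems_rho.1 hb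
      exact ⟨y, hy, (ih y).symm⟩
    · rintro ⟨y, hy, rfl⟩
      exact ⟨_, t.mem_elems_rho.2 ⟨y, hy, rfl⟩, ih y⟩

theorem rho_subtree (x : t.Node) (n : ℕ) (y : (t.subtree x).Node) :
    (t.subtree x).rho n y = t.rho n y.1 := by
  induction n generalizing y with
  | zero => rfl
  | succ n ih =>
    refine V_ext fun c => ?_
    rw [mem_elems_rho, mem_elems_rho]
    constructor
    · rintro ⟨z, hz, rfl⟩
      exact ⟨z.1, hz, (ih z).symm⟩
    · rintro ⟨z, hz, rfl⟩
      exact ⟨⟨z, y.2.tail hz⟩, hz, ih _⟩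

theorem partialMap_eq_rho (n : ℕ) : partialMap n t = t.rho n t.root := by
  induction n generalizing t with
  | zero => rfl
  | succ n ih =>
    refine V_ext fun c => ?_
    rw [mem_elems_partialMap, mem_elems_rho]
    refine exists_congr fun x => and_congr_right fun _ => ?_
    rw [ih, rho_subtree]
    rfl

theorem partialMap_subtree (n : ℕ) (x : t.Node) : partialMap n (t.subtree x) = t.rho n x := by
  rw [partialMap_eq_rho, rho_subtree]
  rfl

/-- The element of `Vomega` with components `ρ n x`. -/
noncomputable def rhoLim (x : t.Node) : Vomega.{u} := ⟨fun n => t.rho n x, fun n => t.conn_rho n x⟩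

theorem leads_rhoLim {x y : t.Node} (h : t.Child x y) : Leads (t.rhoLim x) (t.rhoLim y) :=
  fun _ => t.mem_elems_rho.2 ⟨y, h, rfl⟩

/-- For each `n` some child agrees with `z` at level `n`; a limit of a subsequence of these children
agrees with `z` at all levels. -/
theorem exists_child_rhoLim_eq (ht : t.CompactlyBranching) {x : t.Node} {z : Vomega.{u}}
    (h : Leads (t.rhoLim x) z) : ∃ y, t.Child x y ∧ t.rhoLim y = z := by
  have h' : ∀ n, ∃ y, t.Child x y ∧ t.rho n y = z.1 n := fun n => t.mem_elems_rho.1 (h n)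
  choose y hy hyz using h'
  obtain ⟨φ, w, hφ, hw, hlim⟩ := ht x y hy
  refine ⟨w, hw, Vomega.ext fun n => ?_⟩
  obtain ⟨m, hm⟩ := hlim n
  -- The index `max m n` is late enough for convergence at level `n`, and the child chosen there
  -- agrees with `z` at level `φ (max m n) ≥ n`, hence at `n`.
  have h1 := hm (max m n) (le_max_left _ _)
  have h2 : n ≤ φ (max m n) := (le_max_right _ _).trans (hφ.id_le _)
  change t.rho n w = _
  rw [← h1]
  exact Vomega.eq_of_le (x := t.rhoLim (y (φ (max m n)))) h2 (hyz _)

theorem IsGraphBisim.rho_eq {t s : DirTree.{u}} {R : t.Node → s.Node → Prop}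
    (hR : IsGraphBisim t s R) (n : ℕ) {x : t.Node} {y : s.Node} (h : R x y) :
    t.rho n x = s.rho n y := by
  induction n generalizing x y with
  | zero => rfl
  | succ n ih =>
    refine V_ext fun c => ?_
    rw [mem_elems_rho, mem_elems_rho]
    constructor
    · rintro ⟨x', hx', rfl⟩
      obtain ⟨y', hy', h'⟩ := (hR x y h).1 x' hx'
      exact ⟨y', hy', (ih h').symm⟩
    · rintro ⟨y', hy', rfl⟩
      obtain ⟨x', hx', h'⟩ := (hR x y h).2 y' hy'
      exact ⟨x', hx', ih h'⟩

/-- By the pigeonhole principle, a sequence in a finite set has a constant subsequence. -/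
theorem FinitelyBranching.compactlyBranching {t : DirTree.{u}} (h : t.FinitelyBranching) :
    t.CompactlyBranching := by
  intro x y hy
  have : Finite {y | t.Child x y} := h x
  obtain ⟨z, hz⟩ := Finite.exists_infinite_fiber
    (fun n => (⟨y n, hy n⟩ : {y | t.Child x y}))
  rw [Set.infinite_coe_iff] at hz
  refine ⟨Nat.nth (fun n => n ∈ (fun n => (⟨y n, hy n⟩ : {y | t.Child x y})) ⁻¹' {z}), z.1,
    Nat.nth_strictMono hz, z.2, fun n => ⟨0, fun p _ => ?_⟩⟩
  have := Nat.nth_mem_of_infinite hz p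
  exact congrArg (fun w : {y | t.Child x y} => t.rho n w.1) this

/-! ### Paths from the root -/

/-- The list of nodes on the path from the root to a node. -/
noncomputable def path (x : t.Node) : List t.Node := (t.existsUnique_path x).choose

theorem isDirPath_path (x : t.Node) : IsDirPath t.Child t.root x (t.path x) :=
  (t.existsUnique_path x).choose_spec.1

theorem path_eq {x : t.Node} {l : List t.Node} (h : IsDirPath t.Child t.root x l) :
    t.path x = l :=
  (t.existsUnique_path x).unique (t.isDirPath_path x) h

theorem path_root : t.path t.root = [t.root] := t.path_eq (IsDirPath.refl _)

theorem path_child {x y : t.Node} (h : t.Child x y) : t.path y = t.path x ++ [y] :=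
  t.path_eq ((t.isDirPath_path x).snoc h)

theorem path_ne_nil (x : t.Node) : t.path x ≠ [] := by
  intro h
  have := (t.isDirPath_path x).2.1
  simp [h] at this

theorem eq_root_or_exists_parent (x : t.Node) : x = t.root ∨ ∃ y, t.Child y x := by
  rcases (t.isDirPath_path x).cases with ⟨_, h⟩ | ⟨_, y, _, _, h⟩
  · exact Or.inl h.symm
  · exact Or.inr ⟨y, h⟩

@[elab_as_elim]
theorem node_induction {p : t.Node → Prop} (root : p t.root)
    (child : ∀ x y, t.Child x y → p x → p y) (x : t.Node) : p x := by
  induction hn : (t.path x).length generalizing x with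
  | zero => exact absurd (List.length_eq_zero_iff.1 hn) (t.path_ne_nil x)
  | succ n ih =>
    rcases t.eq_root_or_exists_parent x with rfl | ⟨y, hy⟩
    · exact root
    · refine child y x hy (ih y ?_)
      rw [t.path_child hy] at hn
      simpa using hn

/-- If the children of any node have different `ρ`-sequences, then the tree is strongly
extensional. -/
theorem stronglyExtensional_of_rhoLim
    (h : ∀ x y z, t.Child x y → t.Child x z → t.rhoLim y = t.rhoLim z → y = z) :
    t.StronglyExtensional := by
  intro R hR x
  induction x using t.node_induction with
  | root => exact fun y hy => (hR.eq_root_right y hy).symm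
  | child x' x hx ih =>
    intro y hxy
    rcases t.eq_root_or_exists_parent y with rfl | ⟨y', hy⟩
    · exact hR.eq_root_left x hxy
    -- The parents are related, hence equal by induction, so only siblings remain to be separated.
    · obtain rfl := ih y' (hR.parents x y x' y' hx hy hxy)
      exact h x' x y hx hy (Vomega.ext fun n => hR.bisim.rho_eq n hxy)

/-- The list of the `ρ`-sequences of the nodes on the path from the root to a node. -/
noncomputable def trace (x : t.Node) : List Vomega.{u} := (t.path x).map t.rhoLim

theorem trace_root : t.trace t.root = [t.rhoLim t.root] := by simp [trace, path_root]

theorem trace_child {x y : t.Node} (h : t.Child x y) :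
    t.trace y = t.trace x ++ [t.rhoLim y] := by
  simp [trace, t.path_child h]

theorem getLast?_trace (x : t.Node) : (t.trace x).getLast? = some (t.rhoLim x) := by
  simp [trace, (t.isDirPath_path x).2.2]

theorem trace_ne_nil (x : t.Node) : t.trace x ≠ [] := by simp [trace, path_ne_nil]

theorem head?_trace (x : t.Node) : (t.trace x).head? = some (t.rhoLim t.root) := by
  simp [trace, (t.isDirPath_path x).2.1]

theorem isChain_trace (x : t.Node) : (t.trace x).IsChain Leads := by
  rw [trace, List.isChain_map]
  exact (t.isDirPath_path x).1.imp fun _ _ => t.leads_rhoLim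

theorem eq_root_of_trace_eq {x : t.Node} (h : t.trace x = t.trace t.root) : x = t.root := by
  rcases t.eq_root_or_exists_parent x with h' | ⟨y, hy⟩
  · exact h'
  · rw [trace_root, t.trace_child hy, List.append_eq_singleton_iff] at h
    simp [trace_ne_nil] at h

theorem rhoLim_eq_of_trace_eq {x y : t.Node} (h : t.trace x = t.trace y) :
    t.rhoLim x = t.rhoLim y := by
  have h1 := t.getLast?_trace x
  rw [h, getLast?_trace] at h1
  exact (Option.some.inj h1).symm

/-- Equality of traces is a tree bisimulation. Equality of `rhoLim` alone would give only a graph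
bisimulation: the whole trace also controls roots and parents. -/
theorem trace_injective (hc : t.CompactlyBranching) (hs : t.StronglyExtensional) :
    Function.Injective t.trace := by
  refine fun x y h => hs (fun x y => t.trace x = t.trace y) ⟨?_, rfl, ?_, ?_, ?_⟩ x y h
  · intro x y h
    have hxy := t.rhoLim_eq_of_trace_eq h
    constructor
    · intro x' hx'
      have h1 := t.leads_rhoLim hx'
      rw [hxy] at h1
      obtain ⟨y', hy', h2⟩ := t.exists_child_rhoLim_eq hc h1
      exact ⟨y', hy', show t.trace x' = t.trace y' by rw [t.trace_child hx', t.trace_child hy', h, h2]⟩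
    · intro y' hy'
      have h1 := t.leads_rhoLim hy'
      rw [← hxy] at h1
      obtain ⟨x', hx', h2⟩ := t.exists_child_rhoLim_eq hc h1
      exact ⟨x', hx', show t.trace x' = t.trace y' by rw [t.trace_child hx', t.trace_child hy', h, h2]⟩
  · exact fun y h => t.eq_root_of_trace_eq h.symm
  · exact fun x h => t.eq_root_of_trace_eq h
  · intro x y x' y' hx hy h
    rw [t.trace_child hx, t.trace_child hy] at h
    exact List.append_inj_left' h rfl

/-- A compactly branching, strongly extensional tree is the unfolding of the `ρ`-sequence of
its root. -/
theorem iso_tr (hc : t.CompactlyBranching) (hs : t.StronglyExtensional) :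
    Iso (tr (t.rhoLim t.root)) t := by
  let f : t.Node → (tr (t.rhoLim t.root)).Node :=
    fun x => ⟨t.trace x, t.head?_trace x, t.isChain_trace x⟩
  have hf : Function.Injective f := fun x y h =>
    t.trace_injective hc hs (congrArg Subtype.val h)
  have hroot : f t.root = (tr (t.rhoLim t.root)).root := Subtype.ext t.trace_root
  have hchild : ∀ x y, t.Child x y → (tr (t.rhoLim t.root)).Child (f x) (f y) := fun x y h =>
    ⟨t.rhoLim x, t.rhoLim y, t.getLast?_trace x, t.leads_rhoLim h, t.trace_child h⟩
  -- Lifting of edges gives surjectivity by induction along the unfolding and, with injectivity, the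
  -- reflection of edges.
  have hlift : ∀ x m, (tr (t.rhoLim t.root)).Child (f x) m → ∃ y, t.Child x y ∧ f y = m := by
    rintro x m ⟨a, b, ha, hab, hm⟩
    have ha' : a = t.rhoLim x := by
      have h1 := t.getLast?_trace x
      exact Option.some.inj (ha.symm.trans h1)
    subst ha'
    obtain ⟨y, hy, rfl⟩ := t.exists_child_rhoLim_eq hc hab
    exact ⟨y, hy, Subtype.ext ((t.trace_child hy).trans hm.symm)⟩
  have hsurj : Function.Surjective f := by
    intro m
    induction m using (tr (t.rhoLim t.root)).node_induction with
    | root => exact ⟨t.root, hroot⟩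
    | child l m h ih =>
      obtain ⟨x, rfl⟩ := ih
      obtain ⟨y, -, hy⟩ := hlift x m h
      exact ⟨y, hy⟩
  refine Iso.symm ⟨⟨Equiv.ofBijective f ⟨hf, hsurj⟩, fun {x y} => ⟨fun h => ?_, hchild x y⟩⟩,
    hroot⟩
  obtain ⟨y', hy', e⟩ := hlift x _ h
  rwa [← hf e]

end DirTree

/-! ### The trees `tr x` -/

theorem tr_child_iff {x y : Vomega.{u}} {l m : (tr x).Node} (hl : l.1.getLast? = some y) :
    (tr x).Child l m ↔ ∃ z, Leads y z ∧ m.1 = l.1 ++ [z] := by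
  constructor
  · rintro ⟨y', z, h, hz, hm⟩
    rw [hl] at h
    obtain rfl := Option.some.inj h
    exact ⟨z, hz, hm⟩
  · rintro ⟨z, hz, hm⟩
    exact ⟨y, z, hl, hz, hm⟩

theorem tr_exists_getLast? {x : Vomega.{u}} (l : (tr x).Node) : ∃ y, l.1.getLast? = some y := by
  have h : l.1 ≠ [] := by
    intro h
    have := l.2.1
    simp [h] at this
  exact ⟨_, List.getLast?_eq_some_getLast h⟩

/-- The child of a node of `tr x` that extends it by the entry `z`. -/
noncomputable def trSnoc {x y z : Vomega.{u}} (l : (tr x).Node) (hl : l.1.getLast? = some y)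
    (hz : Leads y z) : (tr x).Node :=
  ⟨l.1 ++ [z], by rw [List.head?_append, l.2.1]; rfl, by
    rw [List.isChain_append]
    refine ⟨l.2.2, by simp, fun a ha b hb => ?_⟩
    rw [hl] at ha
    simp at ha hb
    subst ha
    subst hb
    exact hz⟩

theorem tr_child_trSnoc {x y z : Vomega.{u}} (l : (tr x).Node) (hl : l.1.getLast? = some y)
    (hz : Leads y z) : (tr x).Child l (trSnoc l hl hz) :=
  (tr_child_iff hl).2 ⟨z, hz, rfl⟩

/-- The subtree at a node depends only on its last entry. That all of `y (n + 1)` is reached is the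
content of `exists_leads`. -/
theorem rho_tr {x y : Vomega.{u}} (n : ℕ) (l : (tr x).Node) (hl : l.1.getLast? = some y) :
    (tr x).rho n l = y.1 n := by
  induction n generalizing y l with
  | zero => rfl
  | succ n ih =>
    refine V_ext fun c => ?_
    rw [DirTree.mem_elems_rho]
    constructor
    · rintro ⟨m, hm, rfl⟩
      obtain ⟨z, hz, hm'⟩ := (tr_child_iff hl).1 hm
      rw [ih m (y := z) (by rw [hm']; simp)]
      exact hz n
    · intro hc
      obtain ⟨z, hz, rfl⟩ := exists_leads y hc
      exact ⟨trSnoc l hl hz, tr_child_trSnoc l hl hz, ih _ (by simp [trSnoc])⟩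

theorem rhoLim_tr {x y : Vomega.{u}} (l : (tr x).Node) (hl : l.1.getLast? = some y) :
    (tr x).rhoLim l = y :=
  Vomega.ext fun n => rho_tr n l hl

theorem partialMap_tr (x : Vomega.{u}) (n : ℕ) : (tr x).partialMap n = x.1 n := by
  rw [DirTree.partialMap_eq_rho]
  exact rho_tr n _ rfl

theorem tr_stronglyExtensional (x : Vomega.{u}) : (tr x).StronglyExtensional := by
  refine (tr x).stronglyExtensional_of_rhoLim fun l m m' hm hm' h => ?_
  obtain ⟨y, hl⟩ := tr_exists_getLast? l
  obtain ⟨z, -, hz⟩ := (tr_child_iff hl).1 hm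
  obtain ⟨z', -, hz'⟩ := (tr_child_iff hl).1 hm'
  rw [rhoLim_tr (y := z) m (by simp [hz]), rhoLim_tr (y := z') m' (by simp [hz'])] at h
  exact Subtype.ext (by rw [hz, hz', h])

theorem tr_compactlyBranching (x : Vomega.{u}) : (tr x).CompactlyBranching := by
  intro l m hm
  obtain ⟨y, hl⟩ := tr_exists_getLast? l
  have h := fun k => (tr_child_iff hl).1 (hm k)
  choose z hz hmz using h
  obtain ⟨φ, w, hφ, hw, hlim⟩ := exists_subseq_leads y z hz
  refine ⟨φ, trSnoc l hl hw, hφ, tr_child_trSnoc l hl hw, fun n => ?_⟩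
  obtain ⟨p, hp⟩ := hlim n
  refine ⟨p, fun q hq => ?_⟩
  rw [rho_tr (y := w) n (trSnoc l hl hw) (by simp [trSnoc]), ← hp q hq]
  exact rho_tr n _ (by simp [hmz])

/-! ### The limit of the terminal chain -/

theorem range_tr : Set.range (fun x : Vomega.{u} => (tr x).cls) = compactTrees.{u} := by
  ext q
  constructor
  · rintro ⟨x, rfl⟩
    exact ⟨tr x, tr_compactlyBranching x, tr_stronglyExtensional x, rfl⟩
  · rintro ⟨t, hc, hs, rfl⟩
    exact ⟨t.rhoLim t.root, Quotient.sound (t.iso_tr hc hs)⟩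

theorem partialMap_cls_tr (x : Vomega.{u}) (n : ℕ) : (tr x).cls.partialMap n = x.1 n :=
  partialMap_tr x n

theorem cls_tr_injective : Function.Injective (fun x : Vomega.{u} => (tr x).cls) := by
  intro x y h
  refine Vomega.ext fun n => ?_
  rw [← partialMap_cls_tr x n, ← partialMap_cls_tr y n]
  exact congrArg (TreeClass.partialMap n) h

/-- Compactly branching, strongly extensional trees are determined by the maps `∂ n`. -/
theorem compactTrees_ext {p q : TreeClass.{u}} (hp : p ∈ compactTrees.{u})
    (hq : q ∈ compactTrees.{u}) (h : ∀ n, p.partialMap n = q.partialMap n) : p = q := by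
  rw [← range_tr] at hp hq
  obtain ⟨x, rfl⟩ := hp
  obtain ⟨y, rfl⟩ := hq
  have : x = y := Vomega.ext fun n => by
    rw [← partialMap_cls_tr x n, ← partialMap_cls_tr y n]
    exact h n
  rw [this]

theorem cls_tr_mem (x : Vomega.{u}) : (tr x).cls ∈ compactTrees.{u} := by
  rw [← range_tr]
  exact ⟨x, rfl⟩

theorem small_compactTrees : Small.{u} compactTrees.{u} := by
  rw [← range_tr]
  infer_instance

theorem treeCone_π_app [Small.{u} compactTrees.{u}] (n : ℕ) (s : Shrink.{u} compactTrees.{u}) :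
    treeCone.π.app (Opposite.op n) s =
      ((equivShrink compactTrees.{u}).symm s).1.partialMap n := rfl

theorem terminalChain_map_succ (n : ℕ) :
    terminalChain.{u}.map (homOfLE (Nat.le_add_right n 1)).op = conn n := by
  exact Functor.ofOpSequence_map_homOfLE_succ conn.{u} n

/-- An element of the point of a cone over the terminal chain defines an element of
`Vomega`. -/
noncomputable def coneElement (c : Cone terminalChain.{u}) (a : c.pt) : Vomega.{u} :=
  ⟨fun n => c.π.app (Opposite.op n) a, fun n => by
    have h := c.w (homOfLE (Nat.le_add_right n 1)).op
    rw [terminalChain_map_succ] at h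
    exact congrArg (fun f => f a) h⟩

/-- The trees form a limit of the terminal chain. -/
noncomputable def treeConeIsLimit [Small.{u} compactTrees.{u}] : IsLimit treeCone.{u} where
  lift c := ↾(fun a => equivShrink compactTrees.{u} ⟨(tr (coneElement c a)).cls, cls_tr_mem _⟩)
  fac c j := by
    ext a
    change treeCone.π.app (Opposite.op j.unop) (equivShrink compactTrees.{u} _) = _
    rw [treeCone_π_app, Equiv.symm_apply_apply]
    exact partialMap_cls_tr _ _
  uniq c m h := by
    ext a
    refine (Equiv.symm_apply_eq (equivShrink compactTrees.{u})).1 ?_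
    refine Subtype.ext (compactTrees_ext (Subtype.prop _) (cls_tr_mem _) fun n => ?_)
    rw [partialMap_cls_tr]
    refine (treeCone_π_app n (m a)).symm.trans ?_
    exact congrArg (fun f => f a) (h (Opposite.op n))

/-! ### The terminal coalgebra -/

theorem finiteTrees_subset : finiteTrees.{u} ⊆ compactTrees.{u} := by
  rintro q ⟨t, hf, hs, rfl⟩
  exact ⟨t, hf.compactlyBranching, hs, rfl⟩

theorem small_finiteTrees : Small.{u} finiteTrees.{u} := by
  have := small_compactTrees.{u}
  exact small_subset finiteTrees_subset

theorem mem_elems_partialMap_cls {q : TreeClass.{u}} {n : ℕ} {a : V.{u} n} :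
    a ∈ elems (q.partialMap (n + 1)) ↔ ∃ p ∈ q.immediateSubtrees, p.partialMap n = a := by
  induction q using Quotient.inductionOn with
  | h t =>
    refine t.mem_elems_partialMap.trans ?_
    constructor
    · rintro ⟨x, hx, rfl⟩
      exact ⟨_, ⟨x, hx, rfl⟩, rfl⟩
    · rintro ⟨_, ⟨x, hx, rfl⟩, rfl⟩
      exact ⟨x, hx, rfl⟩

theorem mem_delta {p q : finiteTrees.{u}} : p ∈ delta q ↔ p.1 ∈ q.1.immediateSubtrees := by
  simp only [delta, Finset.mem_map, Finset.mem_attach, true_and]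
  constructor
  · rintro ⟨⟨r, hr⟩, rfl⟩
    exact (Set.Finite.mem_toFinset _).1 hr
  · intro h
    exact ⟨⟨p.1, (Set.Finite.mem_toFinset _).2 h⟩, rfl⟩

/-! ### Behaviours of coalgebra states and their unfoldings -/

section unfold

variable {A : Type u} (c : A → Finset A)

open Classical in
/-- The sequence of approximations of the behaviour of a state of a coalgebra. -/
noncomputable def behaviourAux : ∀ n : ℕ, A → V.{u} n
  | 0, _ => PUnit.unit
  | n + 1, a => mkV ((c a).image (behaviourAux n))

theorem mem_elems_behaviourAux {n : ℕ} {a : A} {v : V.{u} n} :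
    v ∈ elems (behaviourAux c (n + 1) a) ↔ ∃ b ∈ c a, behaviourAux c n b = v := by
  simp [behaviourAux, elems, mkV]

theorem conn_behaviourAux (n : ℕ) (a : A) :
    conn n (behaviourAux c (n + 1) a) = behaviourAux c n a := by
  induction n generalizing a with
  | zero => rfl
  | succ n ih =>
    refine V_ext fun v => ?_
    rw [mem_elems_conn, mem_elems_behaviourAux]
    constructor
    · rintro ⟨w, hw, rfl⟩
      obtain ⟨b, hb, rfl⟩ := (mem_elems_behaviourAux c).1 hw
      exact ⟨b, hb, (ih b).symm⟩
    · rintro ⟨b, hb, rfl⟩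
      exact ⟨_, (mem_elems_behaviourAux c).2 ⟨b, hb, rfl⟩, ih b⟩

/-- The behaviour in `Vomega` of a state of a coalgebra. -/
noncomputable def behaviour (a : A) : Vomega.{u} :=
  ⟨fun n => behaviourAux c n a, fun n => conn_behaviourAux c n a⟩

/-- Each level of `z` is matched by some state in the finite set `c a`, so one state matches
infinitely many levels, and therefore all of them. -/
theorem leads_behaviour_iff {a : A} {z : Vomega.{u}} :
    Leads (behaviour c a) z ↔ ∃ b ∈ c a, behaviour c b = z := by
  constructor
  · intro h
    have h' : ∀ n, ∃ b : c a, behaviourAux c n b.1 = z.1 n := fun n => by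
      obtain ⟨b, hb, e⟩ := (mem_elems_behaviourAux c).1 (h n)
      exact ⟨⟨b, hb⟩, e⟩
    choose b hb using h'
    obtain ⟨b₀, h₀⟩ := Finite.exists_infinite_fiber b
    rw [Set.infinite_coe_iff] at h₀
    refine ⟨b₀.1, b₀.2, Vomega.ext fun n => ?_⟩
    obtain ⟨m, hm, hnm⟩ := h₀.exists_gt n
    refine Vomega.eq_of_le hnm.le ?_
    have hm' : b m = b₀ := hm
    rw [← hm']
    exact hb m
  · rintro ⟨b, hb, rfl⟩ n
    exact (mem_elems_behaviourAux c).2 ⟨b, hb, rfl⟩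

/-- This makes the finiteness from `leads_behaviour_iff` available at every node, not only at the
root. -/
theorem exists_getLast?_tr_behaviour (a : A) (l : (tr (behaviour c a)).Node) :
    ∃ b, l.1.getLast? = some (behaviour c b) := by
  induction l using (tr (behaviour c a)).node_induction with
  | root => exact ⟨a, rfl⟩
  | child l m h ih =>
    obtain ⟨b, hb⟩ := ih
    obtain ⟨z, hz, hm⟩ := (tr_child_iff hb).1 h
    obtain ⟨b', -, rfl⟩ := (leads_behaviour_iff c).1 hz
    exact ⟨b', by simp [hm]⟩

theorem tr_behaviour_finitelyBranching (a : A) : (tr (behaviour c a)).FinitelyBranching := by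
  intro l
  obtain ⟨b, hb⟩ := exists_getLast?_tr_behaviour c a l
  refine Set.Finite.of_finite_image (f := Subtype.val) (((c b).finite_toSet.image
    (fun b' => l.1 ++ [behaviour c b'])).subset ?_) Subtype.val_injective.injOn
  rintro _ ⟨m, hm, rfl⟩
  obtain ⟨z, hz, hm'⟩ := (tr_child_iff hb).1 hm
  obtain ⟨b', hb', rfl⟩ := (leads_behaviour_iff c).1 hz
  exact ⟨b', hb', hm'.symm⟩

/-- The finitely branching, strongly extensional tree of a state of a coalgebra. -/
noncomputable def unfold (a : A) : finiteTrees.{u} :=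
  ⟨(tr (behaviour c a)).cls, _, tr_behaviour_finitelyBranching c a, tr_stronglyExtensional _, rfl⟩

theorem partialMap_unfold (n : ℕ) (a : A) :
    (unfold c a).1.partialMap n = behaviourAux c n a :=
  partialMap_cls_tr _ _

theorem finiteTrees_ext {p q : finiteTrees.{u}}
    (h : ∀ n, p.1.partialMap n = q.1.partialMap n) : p = q :=
  Subtype.ext (compactTrees_ext (finiteTrees_subset p.2) (finiteTrees_subset q.2) h)

/-- This is the homomorphism property of `unfold`. Subtrees of an unfolding are identified through
their `∂ n`, without constructing isomorphisms. -/
theorem mem_delta_unfold {a : A} {p : finiteTrees.{u}} :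
    p ∈ delta (unfold c a) ↔ ∃ b ∈ c a, unfold c b = p := by
  rw [mem_delta]
  have hroot : (tr (behaviour c a)).root.1.getLast? = some (behaviour c a) := rfl
  constructor
  · rintro ⟨l, hl, hp⟩
    obtain ⟨z, hz, hlz⟩ := (tr_child_iff hroot).1 hl
    obtain ⟨b, hb, rfl⟩ := (leads_behaviour_iff c).1 hz
    refine ⟨b, hb, finiteTrees_ext fun n => ?_⟩
    rw [partialMap_unfold, hp]
    exact ((DirTree.partialMap_subtree _ n l).trans (rho_tr (y := behaviour c b) n l (by simp [hlz]))).symm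
  · rintro ⟨b, hb, rfl⟩
    have hz := (leads_behaviour_iff c).2 ⟨b, hb, rfl⟩
    have hl := tr_child_trSnoc _ hroot hz
    have hmem : ((tr (behaviour c a)).subtree (trSnoc _ hroot hz)).cls ∈
        (unfold c a).1.immediateSubtrees := ⟨_, hl, rfl⟩
    -- Closure of `D` under immediate subtrees puts the subtree in `D`, so that `finiteTrees_ext`
    -- applies to it.
    have e : unfold c b = ⟨_, immediateSubtrees_subset (unfold c a).2 hmem⟩ := by
      refine finiteTrees_ext fun n => ?_
      rw [partialMap_unfold]
      exact ((DirTree.partialMap_subtree _ n _).trans (rho_tr (y := behaviour c b) n (trSnoc _ hroot hz)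
        (by simp [trSnoc]))).symm
    rw [e]
    exact hmem

/-- A map that commutes with the structure maps is the unfolding. -/
theorem eq_unfold {h : A → finiteTrees.{u}}
    (hh : ∀ a p, p ∈ delta (h a) ↔ ∃ b ∈ c a, h b = p) (a : A) : h a = unfold c a := by
  -- Any homomorphism has `∂ n` satisfying the recursion that defines `behaviourAux`.
  refine finiteTrees_ext fun n => ?_
  rw [partialMap_unfold]
  induction n generalizing a with
  | zero => rfl
  | succ n ih =>
    refine V_ext fun v => ?_
    rw [mem_elems_partialMap_cls, mem_elems_behaviourAux]
    constructor
    · rintro ⟨p, hp, rfl⟩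
      obtain ⟨b, hb, e⟩ := (hh a ⟨p, immediateSubtrees_subset (h a).2 hp⟩).1 (mem_delta.2 hp)
      exact ⟨b, hb, by rw [← ih, e]⟩
    · rintro ⟨b, hb, rfl⟩
      exact ⟨(h b).1, mem_delta.1 ((hh a (h b)).2 ⟨b, hb, rfl⟩), ih b⟩

end unfold

/-- The structure map of a coalgebra, as a map to finite subsets. -/
def Coalgebra.next (C : Endofunctor.Coalgebra Powf.{u}) (a : C.V) : Finset C.V := C.str a

theorem mem_next_treeCoalgebra [Small.{u} finiteTrees.{u}] {s r : Shrink.{u} finiteTrees.{u}} :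
    r ∈ Coalgebra.next treeCoalgebra.{u} s ↔
      (equivShrink finiteTrees.{u}).symm r ∈ delta ((equivShrink finiteTrees.{u}).symm s) := by
  change r ∈ Finset.map (equivShrink finiteTrees.{u}).toEmbedding _ ↔ _
  rw [Finset.mem_map_equiv]

/-- A map is a coalgebra homomorphism if and only if it commutes with taking successors. -/
theorem str_comp_map_eq_iff {C E : Endofunctor.Coalgebra Powf.{u}} (f : C.V ⟶ E.V) :
    C.str ≫ Powf.map f = f ≫ E.str ↔
      ∀ a b, b ∈ Coalgebra.next E (f a) ↔ ∃ a' ∈ Coalgebra.next C a, f a' = b := by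
  classical
  have key : ∀ a b, b ∈ Finset.image f (Coalgebra.next C a) ↔
      ∃ a' ∈ Coalgebra.next C a, f a' = b := fun _ _ => Finset.mem_image
  have hmap : ∀ a, (C.str ≫ Powf.map f) a = Finset.image f (Coalgebra.next C a) := by
    intro a
    refine Finset.ext fun b => ?_
    rw [key]
    exact Finset.mem_image
  constructor
  · intro h a b
    rw [← key, ← hmap, h]
    rfl
  · intro h
    ext a
    refine (hmap a).trans (Finset.ext fun b => ?_)
    rw [key, ← h]
    rfl

/-- The coalgebra of finitely branching, strongly extensional trees is terminal. -/
noncomputable def treeCoalgebraIsTerminal [Small.{u} finiteTrees.{u}] :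
    IsTerminal treeCoalgebra.{u} :=
  IsTerminal.ofUniqueHom
    (fun C =>
      { f := ↾(fun a => equivShrink finiteTrees.{u} (unfold (Coalgebra.next C) a))
        h := by
          refine (str_comp_map_eq_iff _).2 fun a r => ?_
          refine mem_next_treeCoalgebra.trans ?_
          have e : (equivShrink finiteTrees.{u}).symm (equivShrink finiteTrees.{u}
              (unfold (Coalgebra.next C) a)) = unfold (Coalgebra.next C) a :=
            Equiv.symm_apply_apply _ _
          refine (iff_of_eq (congrArg (fun q => _ ∈ delta q) e)).trans ?_
          refine (mem_delta_unfold _).trans ?_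
          exact exists_congr fun b => and_congr_right fun _ =>
            Equiv.eq_symm_apply (equivShrink finiteTrees.{u}) })
    (fun C m => by
      ext a
      refine (Equiv.symm_apply_eq (equivShrink finiteTrees.{u})).1 ?_
      refine eq_unfold (Coalgebra.next C)
        (h := fun a => (equivShrink finiteTrees.{u}).symm (m.f a)) (fun a p => ?_) a
      have h := (str_comp_map_eq_iff m.f).1 m.h a (equivShrink finiteTrees.{u} p)
      have h' := mem_next_treeCoalgebra (s := m.f a) (r := equivShrink finiteTrees.{u} p)
      rw [Equiv.symm_apply_apply] at h'
      refine h'.symm.trans (h.trans ?_)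
      exact exists_congr fun b => and_congr_right fun _ =>
        (Equiv.symm_apply_eq (equivShrink finiteTrees.{u})).symm)

end Worrell

theorem theoremT :
    -- the set `T = {tr x | x ∈ Vomega}` consists of the compactly branching, strongly
    -- extensional trees; `x ↦ tr x` is a bijection onto it with `∂ n (tr x) = x n`
    Set.range (fun x : Worrell.Vomega.{u} => (Worrell.tr x).cls) = Worrell.compactTrees.{u} ∧
    Function.Injective (fun x : Worrell.Vomega.{u} => (Worrell.tr x).cls) ∧
    (∀ (x : Worrell.Vomega.{u}) (n : ℕ), (Worrell.tr x).cls.partialMap n = x.1 n) ∧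
    -- these trees form a set, which is the limit of the terminal chain with projections `∂ n`
    (∃ _ : Small.{u} Worrell.compactTrees.{u},
      Nonempty (CategoryTheory.Limits.IsLimit Worrell.treeCone.{u})) ∧
    -- the finitely branching, strongly extensional trees form a set, which with the immediate
    -- subtrees map is a terminal coalgebra for the finite power set functor
    (∃ _ : Small.{u} Worrell.finiteTrees.{u},
      Nonempty (CategoryTheory.Limits.IsTerminal Worrell.treeCoalgebra.{u})) :=
  ⟨Worrell.range_tr, Worrell.cls_tr_injective, Worrell.partialMap_cls_tr,
    ⟨Worrell.small_compactTrees, ⟨@Worrell.treeConeIsLimit Worrell.small_compactTrees⟩⟩,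
    ⟨Worrell.small_finiteTrees, ⟨@Worrell.treeCoalgebraIsTerminal Worrell.small_finiteTrees⟩⟩⟩
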